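/- For an integer-valued random variable $X$ write $f_X(k)=\mathbb P(X=k)$, $\|f_X\|_\infty=\sup_{k\in\mathbb Z} f_X(k)$ and $H_\infty(X)=-\log\|f_X\|_\infty$. For a finite set $M\subset\mathbb Z$ and $C>0$ let $$\mathcal P_C(M)=\Big\{f\colon M\to[0,1]\ :\ 0\le f\le \tfrac1C,\ \sum_{i\in M}f(i)=1\Big\},$$ regarded as a set of functions on $\mathbb Z$ by extension by zero, and let $\mathcal E(\mathcal P_C(M))$ be its set of extreme points. Let $n\ge 0$ and let $C_1,\dots,C_n$ be real numbers such that, for each $i$, either $C_i\in(1,2]$ or $C_i$ is an integer with $C_i\ge 3$. Then there exist independent integer-valued random variables $Z_1,\dots,Z_n$, with laws depending only on $C_1,\dots,C_n$, such that 1. $f_{Z_i}\in\mathcal E\big(\mathcal P_{C_i}(\{0,1,\dots,\lfloor C_i\rfloor\})\big)$ for every $i$; 2. $Z_i$ is a Bernoulli variable (with values in $\{0,1\}$) whenever $C_i\in(1,2]$ (so, by 1, $\mathbb P(Z_i=1)\in\{1/C_i,\,1-1/C_i\}$), and $Z_i$ is uniform on $\{0,1,\dots,C_i-1\}$ whenever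 $C_i\ge 3$ is an integer; 3. for all independent integer-valued random variables $X_1,\dots,X_n$ with $\|f_{X_i}\|_\infty\le 1/C_i$ for every $i$, $$H_\infty(X_1+\cdots+X_n)\ \ge\ H_\infty(Z_1+\cdots+Z_n).$$ -/

import Mathlib

open MeasureTheory

noncomputable section

namespace MinEntropy

/-- The probability mass function `f_X(k) = ℙ(X = k)` of an integer valued random variable. -/
def massFn {Ω : Type*} [MeasurableSpace Ω] (P : Measure Ω) (X : Ω → ℤ) (k : ℤ) : ℝ :=
  P.real {ω | X ω = k}

/-- The supremum norm `‖f‖_∞` of a function on the integers. -/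
def supNorm (f : ℤ → ℝ) : ℝ := ⨆ k : ℤ, |f k|

/-- The min-entropy `H_∞(X) = -log ‖f_X‖_∞`. -/
def minEntropy {Ω : Type*} [MeasurableSpace Ω] (P : Measure Ω) (X : Ω → ℤ) : ℝ :=
  -Real.log (supNorm (massFn P X))

/-- The probability mass functions on the finite set `M` that are bounded by `1 / C`; a function
on `M` is identified with its extension by zero to the integers. -/
def boundedDensities (C : ℝ) (M : Finset ℤ) : Set (ℤ → ℝ) :=
  {f | (∀ i ∉ M, f i = 0) ∧ (∀ i ∈ M, 0 ≤ f i ∧ f i ≤ 1 / C) ∧ ∑ i ∈ M, f i = 1}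

end MinEntropy

end

/-! Fix k. By independence, the probability that the sum of the X_i equals k is affine in the law of
each X_i: with the other laws fixed it is the integral of h(a) = P(the rest sums to k - a). Under
the bound 1/C_i such an integral is largest when the largest values of h carry as much mass as
allowed (bathtub principle). So each law may be replaced by a two-point law with masses 1/C_i and 1
- 1/C_i, or by a uniform law on C_i points (`exists_pi_real_sum_le`). Each of these is the image,
under a strictly increasing ψ_i, of a log-concave law on a chain {0, ..., m_i - 1}.

The positions of the atoms are then removed combinatorially. The solutions of ∑ ψ_i(x_i) = k form an
antichain in the product of the chains, and the sets ∑ x_i = l are its levels; an antichain weighs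
at most as much as the heaviest level (`sum_antichain_le`). This weighted Sperner property comes
from Efron's theorem (`levelSum_efron`): the conditional mean of an increasing function given ∑ x_i
= l increases with l. For indicators of up-sets this is normalized matching, which yields an LYM
inequality.

Only the orientations of the Bernoulli laws remain. There are finitely many, and Z takes the most
concentrated choice. -/

namespace MinEntropy

/-! ### Log-concave sequences and convolution -/

/-- Log-concavity of a sequence indexed by the natural numbers. -/
def LogConcaveNat (w : ℕ → ℝ) : Prop := ∀ i l, i ≤ l → w i * w (l + 1) ≤ w (i + 1) * w l

/-- Log-concavity of a sequence indexed by the integers. -/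
def LogConcaveInt (f : ℤ → ℝ) : Prop := ∀ a b, a ≤ b → f a * f (b + 1) ≤ f (a + 1) * f b

/-- Moving the two arguments one step towards each other never decreases the product; iterating this
covers any gap, and when the arguments meet the two sides agree. -/
lemma LogConcaveInt.shift {f : ℤ → ℝ} (hf : LogConcaveInt f) (t : ℕ) :
    ∀ a b, a ≤ b → f a * f (b + t) ≤ f (a + t) * f b := by
  induction t with
  | zero => intro a b _; simp
  | succ t ih =>
    intro a b hab
    rcases hab.eq_or_lt with rfl | hlt
    · exact (mul_comm _ _).le
    · have h1 := hf a (b + t) (by omega)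
      have h2 := ih (a + 1) b (by omega)
      push_cast
      rw [← add_assoc b, show a + ((t : ℤ) + 1) = a + 1 + t by ring]
      exact h1.trans h2

/-- The basic composition formula for `2 × 2` minors, as an inequality. -/
lemma sum_mul_sum_le_of_minors (s : Finset ℕ) (F E w u : ℕ → ℝ)
    (hF : ∀ j l, j ≤ l → F l * E j ≤ F j * E l) (hw : ∀ j l, j ≤ l → u j * w l ≤ w j * u l) :
    (∑ j ∈ s, F j * u j) * (∑ j ∈ s, E j * w j) ≤
      (∑ j ∈ s, F j * w j) * (∑ j ∈ s, E j * u j) := by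
  have h1 : (∑ j ∈ s, F j * w j) * (∑ j ∈ s, E j * u j)
      - (∑ j ∈ s, F j * u j) * (∑ j ∈ s, E j * w j) =
      ∑ j ∈ s, ∑ l ∈ s, F j * E l * (w j * u l - u j * w l) := by
    rw [Finset.sum_mul_sum, Finset.sum_mul_sum, ← Finset.sum_sub_distrib]
    refine Finset.sum_congr rfl fun j _ => ?_
    rw [← Finset.sum_sub_distrib]
    exact Finset.sum_congr rfl fun l _ => by ring
  -- Symmetrising in j and l turns twice the difference into a sum of products of two minors. Both
  -- change sign under the swap, so every product is nonnegative.
  have h2 : ∑ j ∈ s, ∑ l ∈ s, F j * E l * (w j * u l - u j * w l) =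
      ∑ j ∈ s, ∑ l ∈ s, F l * E j * (w l * u j - u l * w j) := Finset.sum_comm
  have h3 : 0 ≤ ∑ j ∈ s, ∑ l ∈ s, (F j * E l - F l * E j) * (w j * u l - u j * w l) := by
    refine Finset.sum_nonneg fun j _ => Finset.sum_nonneg fun l _ => ?_
    rcases le_total j l with h | h
    · exact mul_nonneg (sub_nonneg.2 (hF j l h)) (sub_nonneg.2 (hw j l h))
    · refine mul_nonneg_of_nonpos_of_nonpos ?_ ?_
      · linarith [hF l j h]
      · linarith [hw l j h]
  have h4 : ∑ j ∈ s, ∑ l ∈ s, (F j * E l - F l * E j) * (w j * u l - u j * w l) =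
      ∑ j ∈ s, ∑ l ∈ s, F j * E l * (w j * u l - u j * w l) +
      ∑ j ∈ s, ∑ l ∈ s, F l * E j * (w l * u j - u l * w j) := by
    rw [← Finset.sum_add_distrib]
    refine Finset.sum_congr rfl fun j _ => ?_
    rw [← Finset.sum_add_distrib]
    exact Finset.sum_congr rfl fun l _ => by ring
  linarith

/-- The convolution of two log-concave sequences is log-concave. -/
lemma LogConcaveInt.conv {f : ℤ → ℝ} (hf : LogConcaveInt f) {w : ℕ → ℝ}
    (hw : LogConcaveNat w) (hw0 : ∀ j, 0 ≤ w j) {N : ℕ} (hN : ∀ j, N ≤ j → w j = 0) :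
    LogConcaveInt fun k => ∑ j ∈ Finset.range N, w j * f (k - j) := by
  intro a b hab
  -- Here u is w delayed by one: against f (c + 1 - j), w produces the convolution at c + 1 and u
  -- the one at c. The extra index N accommodates the delay and costs nothing, as w N = 0.
  obtain ⟨u, hu0, hu⟩ : ∃ u : ℕ → ℝ, u 0 = 0 ∧ ∀ j, u (j + 1) = w j :=
    ⟨fun j => if j = 0 then 0 else w (j - 1), by simp, by simp⟩
  have key := sum_mul_sum_le_of_minors (Finset.range (N + 1)) (fun j => f (a + 1 - j))
    (fun j => f (b + 1 - j)) w u ?_ ?_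
  · have e1 : ∀ c : ℤ, ∑ j ∈ Finset.range (N + 1), f (c + 1 - j) * u j =
        ∑ j ∈ Finset.range N, w j * f (c - j) := by
      intro c
      rw [Finset.sum_range_succ']
      simp only [hu, hu0, mul_zero, add_zero]
      refine Finset.sum_congr rfl fun j _ => ?_
      rw [mul_comm]; congr 2; push_cast; ring
    have e2 : ∀ c : ℤ, ∑ j ∈ Finset.range (N + 1), f (c + 1 - j) * w j =
        ∑ j ∈ Finset.range N, w j * f (c + 1 - j) := by
      intro c
      rw [Finset.sum_range_succ, hN N le_rfl, mul_zero, add_zero]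
      exact Finset.sum_congr rfl fun j _ => mul_comm _ _
    rwa [e1, e2, e1, e2] at key
  · intro j l hjl
    obtain ⟨t, rfl⟩ := Nat.exists_eq_add_of_le hjl
    have := hf.shift t (a + 1 - (j + t)) (b + 1 - (j + t)) (by omega)
    have e1 : a + 1 - ((j : ℤ) + t) + t = a + 1 - j := by ring
    have e2 : b + 1 - ((j : ℤ) + t) + t = b + 1 - j := by ring
    rw [e1, e2] at this
    push_cast
    exact this
  · intro j l hjl
    cases j with
    | zero =>
      rw [hu0, zero_mul]
      cases l with
      | zero => simp [hu0]
      | succ l => rw [hu]; exact mul_nonneg (hw0 _) (hw0 _)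
    | succ j =>
      cases l with
      | zero => omega
      | succ l => rw [hu, hu]; exact hw j l (by omega)

/-! ### Efron's monotonicity theorem -/

/-- A comparison of two weighted averages along a staircase: mass is transported from `j` to
`j` and `j + 1` only. -/
lemma staircase_transport (N : ℕ) (ρ ρ' g g' : ℕ → ℝ) (hρ : ∀ j, 0 ≤ ρ j) (hρ' : ∀ j, 0 ≤ ρ' j)
    (h1 : ∀ i l, i < l → ρ l * ρ' i ≤ ρ i * ρ' l)
    (h2 : ∀ i l, i < l → ρ i * ρ' (l + 1) ≤ ρ l * ρ' (i + 1))
    (hg : ∀ j < N, ρ j ≠ 0 → ρ' j ≠ 0 → g j ≤ g' j)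
    (hg' : ∀ j, j + 1 < N → g j ≤ g' (j + 1)) :
    (∑ j ∈ Finset.range N, ρ j * g j) * (∑ j ∈ Finset.range N, ρ' j) ≤
      (∑ j ∈ Finset.range N, ρ' j * g' j) * (∑ j ∈ Finset.range N, ρ j) := by
  set S : ℕ → ℝ := fun j => ∑ i ∈ Finset.range j, ρ i with hS
  set S' : ℕ → ℝ := fun j => ∑ i ∈ Finset.range j, ρ' i with hS'
  have hSs : ∀ j, S (j + 1) = S j + ρ j := fun j => Finset.sum_range_succ _ _
  have hSs' : ∀ j, S' (j + 1) = S' j + ρ' j := fun j => Finset.sum_range_succ _ _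
  -- After scaling both measures to total mass S N * S' N, x j is the mass moved from j - 1 to j and
  -- y j the mass staying at j. `h1` makes x nonnegative (stochastic domination), `h2` makes y
  -- nonnegative (no jump longer than one).
  set x : ℕ → ℝ := fun j => S' N * S j - S N * S' j with hx
  set y : ℕ → ℝ := fun j => S N * S' (j + 1) - S' N * S j with hy
  have hx0 : ∀ j ≤ N, 0 ≤ x j := by
    intro j hj
    have eT : S N = S j + ∑ l ∈ Finset.Ico j N, ρ l := (Finset.sum_range_add_sum_Ico _ hj).symm
    have eT' : S' N = S' j + ∑ l ∈ Finset.Ico j N, ρ' l :=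
      (Finset.sum_range_add_sum_Ico _ hj).symm
    have : (∑ l ∈ Finset.Ico j N, ρ l) * S' j ≤ (∑ l ∈ Finset.Ico j N, ρ' l) * S j := by
      rw [hS, hS', Finset.sum_mul_sum, Finset.sum_mul_sum]
      refine Finset.sum_le_sum fun l hl => Finset.sum_le_sum fun i hi => ?_
      rw [Finset.mem_Ico] at hl
      rw [Finset.mem_range] at hi
      linarith [h1 i l (by omega)]
    simp only [hx]
    rw [eT, eT']
    linarith
  have hy0 : ∀ j < N, 0 ≤ y j := by
    intro j hj
    have eT : S N = S j + ∑ l ∈ Finset.Ico j N, ρ l :=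
      (Finset.sum_range_add_sum_Ico _ hj.le).symm
    have eT' : S' N = S' (j + 1) + ∑ l ∈ Finset.Ico (j + 1) N, ρ' l :=
      (Finset.sum_range_add_sum_Ico _ hj).symm
    have e1 : ∑ l ∈ Finset.Ico (j + 1) N, ρ' l = ∑ l ∈ Finset.Ico j (N - 1), ρ' (l + 1) := by
      rw [Finset.sum_Ico_add' (fun l => ρ' l) j (N - 1) 1, Nat.sub_add_cancel (by omega)]
    have e2 : ∑ l ∈ Finset.Ico j (N - 1), ρ l ≤ ∑ l ∈ Finset.Ico j N, ρ l :=
      Finset.sum_le_sum_of_subset_of_nonneg (Finset.Ico_subset_Ico le_rfl (by omega))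
        fun _ _ _ => hρ _
    have e3 : ∑ i ∈ Finset.range j, ρ' (i + 1) ≤ S' (j + 1) := by
      rw [hS']
      simp only
      rw [Finset.sum_range_succ']
      linarith [hρ' 0]
    have : (∑ l ∈ Finset.Ico j (N - 1), ρ' (l + 1)) * S j ≤
        (∑ l ∈ Finset.Ico j (N - 1), ρ l) * ∑ i ∈ Finset.range j, ρ' (i + 1) := by
      rw [hS, Finset.sum_mul_sum, Finset.sum_mul_sum]
      refine Finset.sum_le_sum fun l hl => Finset.sum_le_sum fun i hi => ?_
      rw [Finset.mem_Ico] at hl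
      rw [Finset.mem_range] at hi
      linarith [h2 i l (by omega)]
    have h4 : (∑ l ∈ Finset.Ico j (N - 1), ρ l) * ∑ i ∈ Finset.range j, ρ' (i + 1) ≤
        (∑ l ∈ Finset.Ico j N, ρ l) * S' (j + 1) :=
      mul_le_mul e2 e3 (Finset.sum_nonneg fun _ _ => hρ' _) (Finset.sum_nonneg fun _ _ => hρ _)
    simp only [hy]
    rw [eT, eT', e1]
    linarith
  have hyρ : ∀ j < N, y j = S' N * ρ j - x (j + 1) := by
    intro j _; simp only [hx, hy, hSs j]; ring
  have hyρ' : ∀ j < N, y j = S N * ρ' j - x j := by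
    intro j _; simp only [hx, hy, hSs' j]; ring
  cases N with
  | zero => simp
  | succ N =>
    have key : 0 ≤ ∑ j ∈ Finset.range (N + 1), y j * (g' j - g j) +
        ∑ j ∈ Finset.range N, x (j + 1) * (g' (j + 1) - g j) := by
      refine add_nonneg (Finset.sum_nonneg fun j hj => ?_) (Finset.sum_nonneg fun j hj => ?_)
      · rw [Finset.mem_range] at hj
        -- Nothing can stay at a point that is null for one of the measures, so `hg` is needed on
        -- the common support only.
        by_cases h : ρ j ≠ 0 ∧ ρ' j ≠ 0
        · exact mul_nonneg (hy0 j hj) (sub_nonneg.2 (hg j hj h.1 h.2))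
        · have : y j = 0 := by
            refine le_antisymm ?_ (hy0 j hj)
            by_cases h' : ρ j = 0
            · rw [hyρ j hj, h']; linarith [hx0 (j + 1) hj]
            · have h'' : ρ' j = 0 := by by_contra h3; exact h ⟨h', h3⟩
              rw [hyρ' j hj, h'']; linarith [hx0 j hj.le]
          simp [this]
      · rw [Finset.mem_range] at hj
        exact mul_nonneg (hx0 _ (by omega)) (sub_nonneg.2 (hg' j (by omega)))
    have e1 : ∑ j ∈ Finset.range (N + 1), x j * g' j =
        ∑ j ∈ Finset.range N, x (j + 1) * g' (j + 1) := by
      rw [Finset.sum_range_succ']; simp [hx, hS, hS']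
    have e2 : ∑ j ∈ Finset.range (N + 1), x (j + 1) * g j =
        ∑ j ∈ Finset.range N, x (j + 1) * g j := by
      rw [Finset.sum_range_succ]; simp [hx, mul_comm]
    have e3 : ∑ j ∈ Finset.range N, x (j + 1) * (g' (j + 1) - g j) =
        ∑ j ∈ Finset.range (N + 1), (x j * g' j - x (j + 1) * g j) := by
      rw [Finset.sum_sub_distrib, e1, e2, ← Finset.sum_sub_distrib]
      exact Finset.sum_congr rfl fun _ _ => by ring
    rw [e3, ← Finset.sum_add_distrib] at key
    have e4 : ∑ j ∈ Finset.range (N + 1), (y j * (g' j - g j) + (x j * g' j - x (j + 1) * g j)) =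
        ∑ j ∈ Finset.range (N + 1), (S (N + 1) * (ρ' j * g' j) - S' (N + 1) * (ρ j * g j)) := by
      refine Finset.sum_congr rfl fun j hj => ?_
      rw [Finset.mem_range] at hj
      linear_combination g' j * hyρ' j hj - g j * hyρ j hj
    rw [e4, Finset.sum_sub_distrib, ← Finset.mul_sum, ← Finset.mul_sum] at key
    linarith

/-- The weighted sum of `φ` over the points of coordinate sum `k` in a product of chains. -/
def levelSum {n : ℕ} (m : Fin n → ℕ) (w : Fin n → ℕ → ℝ) (φ : (Fin n → ℕ) → ℝ) (k : ℤ) : ℝ :=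
  ∑ x ∈ Fintype.piFinset fun i => Finset.range (m i),
    if ∑ i, (x i : ℤ) = k then (∏ i, w i (x i)) * φ x else 0

lemma sum_piFinset_succ {n : ℕ} (m : Fin (n + 1) → ℕ) (F : (Fin (n + 1) → ℕ) → ℝ) :
    ∑ x ∈ Fintype.piFinset (fun i => Finset.range (m i)), F x =
      ∑ j ∈ Finset.range (m 0), ∑ x ∈ Fintype.piFinset (fun i : Fin n => Finset.range (m i.succ)),
        F (Fin.cons j x) := by
  rw [← Finset.sum_product']
  refine Finset.sum_bij' (fun x _ => (x 0, Fin.tail x)) (fun p _ => Fin.cons p.1 p.2) ?_ ?_ ?_ ?_ ?_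
  · intro x hx
    simp only [Fintype.mem_piFinset, Finset.mem_product] at hx ⊢
    exact ⟨hx 0, fun i => hx i.succ⟩
  · intro p hp
    simp only [Fintype.mem_piFinset, Finset.mem_product] at hp ⊢
    intro i
    refine Fin.cases ?_ (fun i => ?_) i
    · simpa using hp.1
    · simpa using hp.2 i
  · intro x _; simp
  · intro p _; simp
  · intro x _; simp

lemma levelSum_succ {n : ℕ} (m : Fin (n + 1) → ℕ) (w : Fin (n + 1) → ℕ → ℝ)
    (φ : (Fin (n + 1) → ℕ) → ℝ) (k : ℤ) :
    levelSum m w φ k = ∑ j ∈ Finset.range (m 0),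
      w 0 j * levelSum (fun i => m i.succ) (fun i => w i.succ) (fun x => φ (Fin.cons j x))
        (k - j) := by
  unfold levelSum
  rw [sum_piFinset_succ]
  refine Finset.sum_congr rfl fun j _ => ?_
  rw [Finset.mul_sum]
  refine Finset.sum_congr rfl fun x _ => ?_
  simp only [Fin.sum_univ_succ, Fin.prod_univ_succ, Fin.cons_zero, Fin.cons_succ]
  have : ((j : ℤ) + ∑ i, (x i : ℤ) = k) ↔ (∑ i, (x i : ℤ) = k - j) := by
    constructor <;> intro h <;> linarith
  simp only [this, mul_ite, mul_zero, mul_assoc]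

section

variable {n : ℕ} {m : Fin n → ℕ} {w : Fin n → ℕ → ℝ}

lemma levelSum_mono (hw0 : ∀ i j, 0 ≤ w i j) {φ ψ : (Fin n → ℕ) → ℝ} {k : ℤ}
    (h : ∀ x ∈ Fintype.piFinset fun i => Finset.range (m i), ∑ i, (x i : ℤ) = k → φ x ≤ ψ x) :
    levelSum m w φ k ≤ levelSum m w ψ k := by
  refine Finset.sum_le_sum fun x hx => ?_
  split_ifs with hk
  · exact mul_le_mul_of_nonneg_left (h x hx hk) (Finset.prod_nonneg fun i _ => hw0 i _)
  · exact le_rfl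

lemma levelSum_nonneg (hw0 : ∀ i j, 0 ≤ w i j) {φ : (Fin n → ℕ) → ℝ} (hφ : ∀ x, 0 ≤ φ x)
    (k : ℤ) : 0 ≤ levelSum m w φ k := by
  refine Finset.sum_nonneg fun x _ => ?_
  split_ifs
  · exact mul_nonneg (Finset.prod_nonneg fun i _ => hw0 i _) (hφ x)
  · exact le_rfl

lemma levelSum_eq_zero (hw0 : ∀ i j, 0 ≤ w i j) {k : ℤ} (h : levelSum m w 1 k = 0)
    (φ : (Fin n → ℕ) → ℝ) : levelSum m w φ k = 0 := by
  unfold levelSum at h ⊢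
  rw [Finset.sum_eq_zero_iff_of_nonneg] at h
  · refine Finset.sum_eq_zero fun x hx => ?_
    have := h x hx
    split_ifs with hk
    · rw [if_pos hk, Pi.one_apply, mul_one] at this
      rw [this, zero_mul]
    · rfl
  · intro x _
    split_ifs
    · exact mul_nonneg (Finset.prod_nonneg fun i _ => hw0 i _) zero_le_one
    · exact le_rfl

end

/-- Efron's monotonicity theorem for products of finite chains with log-concave weights. -/
theorem levelSum_efron {n : ℕ} : ∀ {m : Fin n → ℕ} {w : Fin n → ℕ → ℝ},
    (∀ i j, 0 ≤ w i j) → (∀ i, LogConcaveNat (w i)) → (∀ i j, m i ≤ j → w i j = 0) →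
    LogConcaveInt (levelSum m w 1) ∧ ∀ φ : (Fin n → ℕ) → ℝ, Monotone φ → ∀ k,
      levelSum m w φ k * levelSum m w 1 (k + 1) ≤ levelSum m w φ (k + 1) * levelSum m w 1 k := by
  induction n with
  | zero =>
    intro m w _ _ _
    have h : ∀ φ k, levelSum m w φ k = if (0 : ℤ) = k then φ fun _ => 0 else 0 := by
      intro φ k
      rw [levelSum, Fintype.piFinset_of_isEmpty, Finset.univ_unique, Finset.sum_singleton]
      simp only [Finset.univ_eq_empty, Finset.sum_empty, Finset.prod_empty, one_mul]
      exact if_congr Iff.rfl (congrArg φ (Subsingleton.elim _ _)) rfl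
    refine ⟨fun a b hab => ?_, fun φ _ k => ?_⟩
    · simp only [h]
      split_ifs <;> first | omega | simp
    · simp only [h]
      split_ifs <;> first | omega | simp
  | succ n ih =>
    intro m w hw0 hw hm
    obtain ⟨hM, hE⟩ := ih (m := fun i => m i.succ) (w := fun i => w i.succ)
      (fun i => hw0 _) (fun i => hw _) (fun i => hm _)
    set M := levelSum (fun i => m i.succ) (fun i => w i.succ) 1 with hMdef
    have hM0 : ∀ k, 0 ≤ M k := levelSum_nonneg (fun i => hw0 _) fun _ => zero_le_one
    have h1 : levelSum m w 1 = fun k => ∑ j ∈ Finset.range (m 0), w 0 j * M (k - j) := by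
      funext k
      rw [levelSum_succ]
      rfl
    refine ⟨?_, fun φ hφ k => ?_⟩
    · rw [h1]
      exact hM.conv (hw 0) (hw0 0) (hm 0)
    -- G s j is the conditional mean of φ when the first coordinate is j and the others sum to s. On
    -- a null level it is 0 by division, which is harmless because the numerator vanishes too.
    · set G : ℤ → ℕ → ℝ := fun s j => levelSum (fun i => m i.succ) (fun i => w i.succ)
        (fun x => φ (Fin.cons j x)) s / M s with hG
      have hGM : ∀ s j, levelSum (fun i => m i.succ) (fun i => w i.succ)
          (fun x => φ (Fin.cons j x)) s = M s * G s j := by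
        intro s j
        by_cases h : M s = 0
        · rw [h, zero_mul]
          exact levelSum_eq_zero (fun i => hw0 _) h _
        · rw [hG, mul_div_cancel₀ _ h]
      -- Passing from level k to k + 1, the first coordinate either stays (the rest gains one:
      -- induction hypothesis) or grows by one (the rest keeps its level: monotonicity of φ). The
      -- minor conditions are log-concavity of M and of w 0.
      have key := staircase_transport (m 0) (fun j => w 0 j * M (k - j))
        (fun j => w 0 j * M (k + 1 - j)) (fun j => G (k - j) j) (fun j => G (k + 1 - j) j)
        (fun j => mul_nonneg (hw0 _ _) (hM0 _)) (fun j => mul_nonneg (hw0 _ _) (hM0 _))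
        ?_ ?_ ?_ ?_
      · simp only [h1]
        rw [levelSum_succ, levelSum_succ]
        simpa only [hGM, mul_assoc] using key
      · intro i l hil
        have h3 := hM (k - l) (k - i) (by omega)
        rw [show k - (i : ℤ) + 1 = k + 1 - i by ring, show k - (l : ℤ) + 1 = k + 1 - l by ring]
          at h3
        have h4 := mul_le_mul_of_nonneg_left h3 (mul_nonneg (hw0 0 i) (hw0 0 l))
        linarith
      · intro i l hil
        have h3 := hw 0 i l hil.le
        have h4 := mul_le_mul_of_nonneg_left h3 (mul_nonneg (hM0 (k - i)) (hM0 (k - l)))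
        push_cast
        rw [show k + 1 - ((i : ℤ) + 1) = k - i by ring, show k + 1 - ((l : ℤ) + 1) = k - l by ring]
        linarith
      · intro j _ h3 h4
        have p1 : 0 < M (k - j) := lt_of_le_of_ne (hM0 _) (Ne.symm (right_ne_zero_of_mul h3))
        have p2 : 0 < M (k + 1 - j) := lt_of_le_of_ne (hM0 _) (Ne.symm (right_ne_zero_of_mul h4))
        simp only [hG]
        rw [div_le_div_iff₀ p1 p2]
        have := hE (fun x => φ (Fin.cons j x)) (fun x y hxy => hφ (Fin.cons_le_cons.2 ⟨le_rfl, hxy⟩))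
          (k - j)
        rwa [show k - (j : ℤ) + 1 = k + 1 - j by ring] at this
      · intro j _
        simp only [hG]
        push_cast
        rw [show k + 1 - ((j : ℤ) + 1) = k - j by ring]
        refine div_le_div_of_nonneg_right ?_ (hM0 _)
        exact levelSum_mono (fun i => hw0 _)
          fun x _ _ => hφ (Fin.cons_le_cons.2 ⟨Nat.le_succ j, le_rfl⟩)

/-! ### Weighted Sperner property -/

lemma levelSum_add {n : ℕ} (m : Fin n → ℕ) (w : Fin n → ℕ → ℝ) (φ ψ : (Fin n → ℕ) → ℝ) (k : ℤ) :
    levelSum m w (φ + ψ) k = levelSum m w φ k + levelSum m w ψ k := by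
  unfold levelSum
  rw [← Finset.sum_add_distrib]
  refine Finset.sum_congr rfl fun x _ => ?_
  split_ifs
  · rw [Pi.add_apply, mul_add]
  · rw [add_zero]

/-- The Sperner property of products of finite chains with log-concave weights: an antichain weighs
at most as much as the heaviest level. -/
theorem sum_antichain_le {n : ℕ} {m : Fin n → ℕ} {w : Fin n → ℕ → ℝ}
    (hw0 : ∀ i j, 0 ≤ w i j) (hw : ∀ i, LogConcaveNat (w i)) (hm : ∀ i j, m i ≤ j → w i j = 0)
    {A : Finset (Fin n → ℕ)} (hAm : A ⊆ Fintype.piFinset fun i => Finset.range (m i))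
    (hA : IsAntichain (· ≤ ·) (A : Set (Fin n → ℕ))) {K : ℝ} (hK : ∀ k, levelSum m w 1 k ≤ K) :
    ∑ x ∈ A, ∏ i, w i (x i) ≤ K := by
  obtain ⟨hM, hE⟩ := levelSum_efron hw0 hw hm
  have hM0 : ∀ k, 0 ≤ levelSum m w 1 k := levelSum_nonneg hw0 fun _ => zero_le_one
  set M := levelSum m w 1 with hMdef
  set V : Set (Fin n → ℕ) := {x | ∃ z ∈ A, z < x} with hV
  set α : (Fin n → ℕ) → ℝ := Set.indicator (A : Set (Fin n → ℕ)) 1 with hα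
  set ν : (Fin n → ℕ) → ℝ := Set.indicator V 1 with hν
  have hα0 : ∀ x, 0 ≤ α x := fun x => Set.indicator_nonneg (fun _ _ => zero_le_one) x
  have hν0 : ∀ x, 0 ≤ ν x := fun x => Set.indicator_nonneg (fun _ _ => zero_le_one) x
  have hdisj : ∀ x ∈ V, x ∉ A := by
    rintro x ⟨z, hz, hzx⟩ hx
    exact hA hz hx hzx.ne hzx.le
  have hle : ∀ x, (α + ν) x ≤ 1 := by
    intro x
    by_cases h1 : x ∈ V
    · have h2 : x ∉ (A : Set (Fin n → ℕ)) := hdisj x h1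
      simp [hα, hν, h1, h2]
    · by_cases h2 : x ∈ (A : Set (Fin n → ℕ))
      · simp [hα, hν, h1, h2]
      · simp [hα, hν, h1, h2]
  have hstep : ∀ k, (levelSum m w α k + levelSum m w ν k) * M (k + 1) ≤
      levelSum m w ν (k + 1) * M k := by
    intro k
    -- W is the up-set generated by the points of level k lying above A. On level k it is all of A ∪
    -- V; on level k + 1 it lies inside V.
    set W : Set (Fin n → ℕ) := {x | ∃ y, (∃ z ∈ A, z ≤ y) ∧ ∑ i, (y i : ℤ) = k ∧ y ≤ x} with hW
    have hmono : Monotone (Set.indicator W (1 : (Fin n → ℕ) → ℝ)) := by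
      intro x x' hxx'
      by_cases hx : x ∈ W
      · have hx' : x' ∈ W := by
          obtain ⟨y, hy, hk, hyx⟩ := hx
          exact ⟨y, hy, hk, hyx.trans hxx'⟩
        rw [Set.indicator_of_mem hx, Set.indicator_of_mem hx', Pi.one_apply, Pi.one_apply]
      · rw [Set.indicator_of_notMem hx]
        exact Set.indicator_nonneg (fun _ _ => zero_le_one) _
    have h1 := hE _ hmono k
    refine (mul_le_mul_of_nonneg_right ?_ (hM0 _)).trans
      (h1.trans (mul_le_mul_of_nonneg_right ?_ (hM0 _)))
    · rw [← levelSum_add]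
      refine levelSum_mono hw0 fun x _ hx => ?_
      by_cases hxW : x ∈ W
      · rw [Set.indicator_of_mem hxW]; exact hle x
      · have h2 : x ∉ (A : Set (Fin n → ℕ)) := fun h => hxW ⟨x, ⟨x, h, le_rfl⟩, hx, le_rfl⟩
        have h3 : x ∉ V := by
          rintro ⟨z, hz, hzx⟩
          exact hxW ⟨x, ⟨z, hz, hzx.le⟩, hx, le_rfl⟩
        simp [hα, hν, h2, h3, hxW]
    · refine levelSum_mono hw0 fun x _ hx => ?_
      by_cases hxW : x ∈ W
      · have hxV : x ∈ V := by
          obtain ⟨y, ⟨z, hz, hzy⟩, hy, hyx⟩ := hxW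
          refine ⟨z, hz, lt_of_le_of_lt hzy (lt_of_le_of_ne hyx ?_)⟩
          rintro rfl
          omega
        rw [hν, Set.indicator_of_mem hxW, Set.indicator_of_mem hxV]
      · rw [Set.indicator_of_notMem hxW]; exact hν0 x
  -- a k is the proportion of level k occupied by A; the LYM inequality to be shown is that these
  -- proportions sum to at most 1.
  set a : ℕ → ℝ := fun k => levelSum m w α k / M k with ha
  have haM : ∀ k : ℕ, levelSum m w α k = a k * M k := by
    intro k
    by_cases h : M k = 0
    · rw [h, mul_zero, levelSum_eq_zero hw0 h]
    · rw [ha, div_mul_cancel₀ _ h]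
  have ha0 : ∀ k, 0 ≤ a k := fun k => div_nonneg (levelSum_nonneg hw0 hα0 _) (hM0 _)
  have hsum : ∀ k : ℕ, (0 < M k → ∑ i ∈ Finset.range k, a i ≤ levelSum m w ν k / M k) ∧
      ∑ i ∈ Finset.range k, a i ≤ 1 := by
    intro k
    induction k with
    | zero =>
      simp only [Finset.range_zero, Finset.sum_empty]
      exact ⟨fun _ => div_nonneg (levelSum_nonneg hw0 hν0 _) (hM0 _), zero_le_one⟩
    | succ k ih =>
      rcases (hM0 k).eq_or_lt with h0 | hpos
      · have hak : a k = 0 := by rw [ha]; simp only; rw [← h0, div_zero]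
        rw [Finset.sum_range_succ, hak, add_zero]
        refine ⟨fun hk1 => ?_, ih.2⟩
        -- Log-concavity excludes internal zeros: if level k is null and level k + 1 is not, all
        -- earlier levels are null.
        have : ∀ i ∈ Finset.range k, a i = 0 := by
          intro i hi
          rw [Finset.mem_range] at hi
          have h2 := hM i k (by omega)
          rw [← h0, mul_zero] at h2
          push_cast at hk1
          have h3 : M i = 0 := by
            rcases (hM0 i).eq_or_lt with h | h
            · exact h.symm
            · exact absurd (mul_pos h hk1) (not_lt.2 h2)
          rw [ha]; simp only; rw [h3, div_zero]
        rw [Finset.sum_eq_zero this]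
        exact div_nonneg (levelSum_nonneg hw0 hν0 _) (hM0 _)
      · have h1 : ∑ i ∈ Finset.range (k + 1), a i ≤
            (levelSum m w α k + levelSum m w ν k) / M k := by
          rw [Finset.sum_range_succ, add_div]
          linarith [ih.1 hpos]
        refine ⟨fun hk1 => h1.trans ?_, h1.trans ?_⟩
        · rw [div_le_div_iff₀ hpos hk1]
          push_cast
          exact hstep k
        · rw [div_le_one hpos, ← levelSum_add]
          exact levelSum_mono hw0 fun x _ _ => hle x
  have hdecomp : ∑ x ∈ A, ∏ i, w i (x i) =
      ∑ k ∈ Finset.range (∑ i, m i + 1), levelSum m w α k := by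
    unfold levelSum
    rw [Finset.sum_comm, ← Finset.sum_subset hAm]
    · refine Finset.sum_congr rfl fun x hx => ?_
      have hx' : x ∈ (A : Set (Fin n → ℕ)) := hx
      rw [Finset.sum_eq_single (∑ i, x i)]
      · rw [if_pos (by push_cast; rfl), hα, Set.indicator_of_mem hx', Pi.one_apply, mul_one]
      · intro k _ hk
        rw [if_neg]
        intro h
        exact hk (by exact_mod_cast h.symm)
      · intro h
        refine absurd (Finset.mem_range.2 (Nat.lt_succ_of_le (Finset.sum_le_sum fun i _ => ?_))) h
        have := Fintype.mem_piFinset.1 (hAm hx) i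
        exact (Finset.mem_range.1 this).le
    · intro x _ hx
      have hx' : x ∉ (A : Set (Fin n → ℕ)) := hx
      refine Finset.sum_eq_zero fun k _ => ?_
      rw [hα, Set.indicator_of_notMem hx', mul_zero, ite_self]
  have hK0 : 0 ≤ K := (hM0 0).trans (hK 0)
  calc ∑ x ∈ A, ∏ i, w i (x i)
      = ∑ k ∈ Finset.range (∑ i, m i + 1), a k * M k := by
        rw [hdecomp]; exact Finset.sum_congr rfl fun k _ => haM k
    _ ≤ ∑ k ∈ Finset.range (∑ i, m i + 1), a k * K :=
        Finset.sum_le_sum fun k _ => mul_le_mul_of_nonneg_left (hK k) (ha0 k)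
    _ = (∑ k ∈ Finset.range (∑ i, m i + 1), a k) * K := (Finset.sum_mul _ _ _).symm
    _ ≤ 1 * K := mul_le_mul_of_nonneg_right (hsum _).2 hK0
    _ = K := one_mul K

/-! ### The bathtub principle -/

/-- If h is positive somewhere off A, a maximum over a finite superlevel set is a maximum off A;
otherwise any point off A serves. -/
lemma exists_forall_notMem_le {h : ℤ → ℝ} (h0 : ∀ j, 0 ≤ h j)
    (hfin : ∀ ε > 0, {j | ε ≤ h j}.Finite) (A : Finset ℤ) :
    ∃ b, b ∉ A ∧ ∀ c, c ∉ A → h c ≤ h b := by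
  by_cases H : ∃ b, b ∉ A ∧ 0 < h b
  · obtain ⟨b, hb, hpos⟩ := H
    have hf : ({j | h b ≤ h j} ∩ {j | j ∉ A}).Finite := (hfin _ hpos).inter_of_left _
    obtain ⟨a, ⟨ha1, ha2⟩, ha⟩ := Set.exists_max_image _ h hf ⟨b, le_refl (h b), hb⟩
    refine ⟨a, ha2, fun c hc => ?_⟩
    by_cases hcb : h b ≤ h c
    · exact ha c ⟨hcb, hc⟩
    · exact (not_le.1 hcb).le.trans ha1
  · push Not at H
    obtain ⟨b, hb⟩ := Infinite.exists_notMem_finset A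
    exact ⟨b, hb, fun c hc => (H c hc).trans (h0 b)⟩

lemma exists_top_finset {h : ℤ → ℝ} (h0 : ∀ j, 0 ≤ h j)
    (hfin : ∀ ε > 0, {j | ε ≤ h j}.Finite) (c : ℕ) :
    ∃ A : Finset ℤ, A.card = c ∧ ∀ a ∈ A, ∀ b ∉ A, h b ≤ h a := by
  induction c with
  | zero => exact ⟨∅, rfl, by simp⟩
  | succ c ih =>
    obtain ⟨A, hc, hA⟩ := ih
    obtain ⟨b, hb, hmax⟩ := exists_forall_notMem_le h0 hfin A
    refine ⟨insert b A, by rw [Finset.card_insert_of_notMem hb, hc], ?_⟩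
    intro a ha d hd
    rw [Finset.mem_insert, not_or] at hd
    rcases Finset.mem_insert.1 ha with rfl | ha
    · exact hmax d hd.2
    · exact hA a ha d hd.2

lemma integrable_of_bounded (ν : Measure ℤ) [IsProbabilityMeasure ν] {h : ℤ → ℝ}
    (h0 : ∀ j, 0 ≤ h j) (h1 : ∀ j, h j ≤ 1) : Integrable h ν :=
  Integrable.of_bound (by fun_prop) 1 (ae_of_all _ fun j => by
    rw [Real.norm_eq_abs, abs_of_nonneg (h0 j)]; exact h1 j)

/-- The bathtub principle for a probability measure on the integers. -/
lemma integral_le_bathtub (ν : Measure ℤ) [IsProbabilityMeasure ν] {h : ℤ → ℝ}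
    (h0 : ∀ j, 0 ≤ h j) (h1 : ∀ j, h j ≤ 1) (A : Finset ℤ) (t : ℝ) (ht : ∀ b ∉ A, h b ≤ t) :
    ∫ j, h j ∂ν ≤ t + ∑ a ∈ A, (h a - t) * ν.real {a} := by
  have hint : ∀ a ∈ A, Integrable (Set.indicator {a} fun _ => h a - t) ν := fun a _ =>
    (integrable_const _).indicator (measurableSet_singleton a)
  -- The integrands compare pointwise, with equality on A and h ≤ t elsewhere.
  calc ∫ j, h j ∂ν ≤ ∫ j, (t + ∑ a ∈ A, Set.indicator {a} (fun _ => h a - t) j) ∂ν := by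
        refine integral_mono (integrable_of_bounded ν h0 h1)
          ((integrable_const t).add (integrable_finsetSum A hint)) fun j => ?_
        by_cases hj : j ∈ A
        · simp only
          rw [Finset.sum_eq_single j]
          · simp
          · intro b _ hb
            exact Set.indicator_of_notMem (by simpa using hb.symm) _
          · exact fun h => absurd hj h
        · simp only
          rw [Finset.sum_eq_zero]
          · rw [add_zero]; exact ht j hj
          · intro b hb
            refine Set.indicator_of_notMem ?_ _
            rintro rfl
            exact hj hb
    _ = t + ∑ a ∈ A, (h a - t) * ν.real {a} := by
        rw [integral_add (integrable_const t) (integrable_finsetSum A hint),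
          integral_finsetSum A hint]
        rw [integral_const, probReal_univ, one_smul]
        congr 1
        refine Finset.sum_congr rfl fun a _ => ?_
        rw [integral_indicator_const _ (measurableSet_singleton a), smul_eq_mul, mul_comm]

/-! ### Product measures on chains -/

/-- The law on the chain `{0, …, m - 1}` with weights `w`. -/
noncomputable def chainMeasure (m : ℕ) (w : ℕ → ℝ) : Measure ℕ :=
  ∑ j ∈ Finset.range m, ENNReal.ofReal (w j) • Measure.dirac j

/-- The weights of a log-concave law on the chain `{0, …, m - 1}`. -/
structure IsChainWeight (m : ℕ) (w : ℕ → ℝ) : Prop where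
  nonneg : ∀ j, 0 ≤ w j
  logConcave : LogConcaveNat w
  eq_zero : ∀ j, m ≤ j → w j = 0
  sum_eq_one : ∑ j ∈ Finset.range m, w j = 1

namespace IsChainWeight

variable {m : ℕ} {w : ℕ → ℝ}

lemma isProbabilityMeasure (hw : IsChainWeight m w) : IsProbabilityMeasure (chainMeasure m w) := by
  constructor
  simp only [chainMeasure, Measure.coe_finsetSum, Finset.sum_apply, Measure.smul_apply,
    measure_univ, smul_eq_mul, mul_one]
  rw [← ENNReal.ofReal_sum_of_nonneg fun j _ => hw.nonneg j, hw.sum_eq_one, ENNReal.ofReal_one]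

lemma measure_singleton (hw : IsChainWeight m w) (j : ℕ) :
    chainMeasure m w {j} = ENNReal.ofReal (w j) := by
  simp only [chainMeasure, Measure.coe_finsetSum, Finset.sum_apply, Measure.smul_apply,
    smul_eq_mul]
  by_cases hj : j < m
  · rw [Finset.sum_eq_single j]
    · simp
    · intro b _ hb
      simp [hb]
    · intro h
      exact absurd (Finset.mem_range.2 hj) h
  · rw [hw.eq_zero j (not_lt.1 hj), ENNReal.ofReal_zero]
    refine Finset.sum_eq_zero fun b hb => ?_
    have : b ≠ j := by have := Finset.mem_range.1 hb; omega
    simp [this]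

lemma integral_eq (hw : IsChainWeight m w) (f : ℕ → ℝ) :
    ∫ j, f j ∂chainMeasure m w = ∑ j ∈ Finset.range m, w j * f j := by
  rw [chainMeasure, integral_finsetSum_measure]
  · refine Finset.sum_congr rfl fun j _ => ?_
    rw [integral_smul_measure, integral_dirac, ENNReal.toReal_ofReal (hw.nonneg j), smul_eq_mul]
  · intro j _
    exact (integrable_dirac (by simp)).smul_measure ENNReal.ofReal_ne_top

end IsChainWeight

lemma pi_chainMeasure_real {n : ℕ} {m : Fin n → ℕ} {w : Fin n → ℕ → ℝ}
    (hw : ∀ i, IsChainWeight (m i) (w i)) (S : Set (Fin n → ℕ)) [DecidablePred (· ∈ S)] :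
    (Measure.pi fun i => chainMeasure (m i) (w i)).real S =
      ∑ x ∈ Fintype.piFinset (fun i => Finset.range (m i)) with x ∈ S, ∏ i, w i (x i) := by
  have := fun i => (hw i).isProbabilityMeasure
  set Q := Measure.pi fun i => chainMeasure (m i) (w i) with hQ
  have hsing : ∀ x : Fin n → ℕ, Q.real {x} = ∏ i, w i (x i) := by
    intro x
    rw [measureReal_def, hQ, Measure.pi_singleton, ENNReal.toReal_prod]
    refine Finset.prod_congr rfl fun i _ => ?_
    rw [(hw i).measure_singleton, ENNReal.toReal_ofReal ((hw i).nonneg _)]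
  set B := Fintype.piFinset fun i => Finset.range (m i) with hB
  have hBone : Q.real B = 1 := by
    rw [← sum_measureReal_singleton]
    simp only [hsing]
    rw [hB, ← Finset.prod_univ_sum]
    exact Finset.prod_eq_one fun i _ => (hw i).sum_eq_one
  have hcompl : Q.real (B : Set (Fin n → ℕ))ᶜ = 0 := by
    rw [probReal_compl_eq_one_sub B.measurableSet, hBone, sub_self]
  have hS : Q.real S = Q.real (S ∩ B) := by
    refine le_antisymm ?_ (measureReal_mono Set.inter_subset_left)
    calc Q.real S ≤ Q.real ((S ∩ B) ∪ (B : Set (Fin n → ℕ))ᶜ) := measureReal_mono (by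
          intro x hx
          by_cases hxB : x ∈ (B : Set (Fin n → ℕ))
          · exact Or.inl ⟨hx, hxB⟩
          · exact Or.inr hxB)
      _ ≤ Q.real (S ∩ B) + Q.real (B : Set (Fin n → ℕ))ᶜ := measureReal_union_le _ _
      _ = Q.real (S ∩ B) := by rw [hcompl, add_zero]
  rw [hS, show S ∩ B = ((B.filter (· ∈ S) : Finset (Fin n → ℕ)) : Set (Fin n → ℕ)) by
    ext x; simp [and_comm], ← sum_measureReal_singleton]
  exact Finset.sum_congr rfl fun x _ => hsing x

lemma pi_chainMeasure_level {n : ℕ} {m : Fin n → ℕ} {w : Fin n → ℕ → ℝ}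
    (hw : ∀ i, IsChainWeight (m i) (w i)) (k : ℤ) :
    (Measure.pi fun i => chainMeasure (m i) (w i)).real {x | ∑ i, (x i : ℤ) = k} =
      levelSum m w 1 k := by
  classical
  rw [pi_chainMeasure_real hw, levelSum, Finset.sum_filter]
  simp

/-- Among all sums of independent strictly increasing images of the coordinates of a product of
log-concave chains, the plain sum of the coordinates is the most concentrated one. -/
theorem pi_map_chainMeasure_le {n : ℕ} {m : Fin n → ℕ} {w : Fin n → ℕ → ℝ}
    (hw : ∀ i, IsChainWeight (m i) (w i)) {ψ : Fin n → ℕ → ℤ}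
    (hψ : ∀ i, StrictMonoOn (ψ i) (Set.Iio (m i))) {K : ℝ}
    (hK : ∀ k, (Measure.pi fun i => chainMeasure (m i) (w i)).real {x | ∑ i, (x i : ℤ) = k} ≤ K)
    (k : ℤ) :
    (Measure.pi fun i => (chainMeasure (m i) (w i)).map (ψ i)).real {x | ∑ i, x i = k} ≤ K := by
  classical
  have := fun i => (hw i).isProbabilityMeasure
  have : ∀ i, IsProbabilityMeasure ((chainMeasure (m i) (w i)).map (ψ i)) := fun i =>
    Measure.isProbabilityMeasure_map (by fun_prop)
  rw [← Measure.pi_map_pi fun i => (measurable_of_countable (ψ i)).aemeasurable,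
    map_measureReal_apply (measurable_of_countable _) (Set.to_countable _).measurableSet,
    pi_chainMeasure_real hw]
  refine sum_antichain_le (fun i => (hw i).nonneg) (fun i => (hw i).logConcave)
    (fun i => (hw i).eq_zero) (Finset.filter_subset _ _) ?_ fun k => ?_
  -- If x < y, strict monotonicity of the ψ i makes the two image sums differ, so they cannot both
  -- be k.
  · intro x hx y hy hne hle
    simp only [Finset.coe_filter, Fintype.mem_piFinset, Finset.mem_range, Set.mem_preimage,
      Set.mem_ofPred_eq] at hx hy
    obtain ⟨hlt, i, hi⟩ := Pi.lt_def.1 (lt_of_le_of_ne hle hne)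
    have : ∑ i, ψ i (x i) < ∑ i, ψ i (y i) :=
      Finset.sum_lt_sum (fun i _ => (hψ i).monotoneOn (hx.1 i) (hy.1 i) (hle i))
        ⟨i, Finset.mem_univ _, hψ i (hx.1 i) (hy.1 i) hi⟩
    omega
  · rw [← pi_chainMeasure_level hw]
    exact hK k

/-! ### Replacing the summands one at a time -/

/-- The law of a sum, as an average over one of the summands. -/
lemma pi_real_sum_eq {n : ℕ} (μ : Fin (n + 1) → Measure ℤ) [∀ i, IsProbabilityMeasure (μ i)]
    (i : Fin (n + 1)) (k : ℤ) :
    (Measure.pi μ).real {x | ∑ i, x i = k} =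
      ∫ a, (Measure.pi fun j => μ (i.succAbove j)).real {y | ∑ j, y j = k - a} ∂μ i := by
  have hmp := measurePreserving_piFinSuccAbove μ i
  set κ := Measure.pi fun j => μ (i.succAbove j) with hκ
  have hset : {x : Fin (n + 1) → ℤ | ∑ i, x i = k} =
      MeasurableEquiv.piFinSuccAbove (fun _ => ℤ) i ⁻¹' {p | p.1 + ∑ j, p.2 j = k} := by
    ext x
    rw [Set.mem_preimage, Set.mem_ofPred_eq, Set.mem_ofPred_eq, Fin.sum_univ_succAbove _ i]
    rfl
  have hms : MeasurableSet {p : ℤ × (Fin n → ℤ) | p.1 + ∑ j, p.2 j = k} :=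
    (Set.to_countable _).measurableSet
  rw [hset, hmp.measureReal_preimage hms.nullMeasurableSet, measureReal_def,
    Measure.prod_apply hms,
    integral_eq_lintegral_of_nonneg_ae (ae_of_all _ fun _ => measureReal_nonneg)
      (measurable_of_countable _).aestronglyMeasurable]
  congr 1
  refine lintegral_congr fun a => ?_
  rw [ofReal_measureReal]
  congr 1
  ext y
  simp only [Set.mem_preimage, Set.mem_ofPred_eq]
  constructor <;> intro h <;> linarith

/-- The events for distinct a are disjoint, so only finitely many have mass at least ε. This lets
the test function attain its largest values. -/
lemma finite_le_real_level {n : ℕ} (κ : Measure (Fin n → ℤ)) [IsProbabilityMeasure κ] (k : ℤ)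
    {ε : ℝ} (hε : 0 < ε) : {a : ℤ | ε ≤ κ.real {y | ∑ j, y j = k - a}}.Finite := by
  have := Measure.finite_const_le_meas_of_disjoint_iUnion κ (ε := ENNReal.ofReal ε)
    (by simpa using hε) (As := fun a : ℤ => {y : Fin n → ℤ | ∑ j, y j = k - a})
    (fun a => (Set.to_countable _).measurableSet) ?_ (measure_ne_top _ _)
  · refine this.subset fun a ha => ?_
    simp only [Set.mem_ofPred_eq] at ha ⊢
    exact (ENNReal.ofReal_le_iff_le_toReal (measure_ne_top _ _)).2 ha
  · intro a b hab
    refine Set.disjoint_left.2 fun y hy hy' => hab ?_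
    simp only [Set.mem_ofPred_eq] at hy hy'
    omega

/-- If every summand can be improved by a law from a given class against every test function that
vanishes at infinity, then all summands can be replaced by laws of the given classes. -/
theorem exists_pi_real_sum_le {n : ℕ} (ν : Fin n → Measure ℤ) [∀ i, IsProbabilityMeasure (ν i)]
    (E : Fin n → Set (Measure ℤ)) (hE : ∀ i, ∀ ρ ∈ E i, IsProbabilityMeasure ρ)
    (hν : ∀ i, ∀ h : ℤ → ℝ, (∀ j, 0 ≤ h j) → (∀ j, h j ≤ 1) → (∀ ε > 0, {j | ε ≤ h j}.Finite) →
      ∃ ρ ∈ E i, ∫ j, h j ∂ν i ≤ ∫ j, h j ∂ρ) (k : ℤ) :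
    ∃ ρ : Fin n → Measure ℤ, (∀ i, ρ i ∈ E i) ∧
      (Measure.pi ν).real {x | ∑ i, x i = k} ≤ (Measure.pi ρ).real {x | ∑ i, x i = k} := by
  suffices H : ∀ s : Finset (Fin n), ∃ ρ : Fin n → Measure ℤ, (∀ i, IsProbabilityMeasure (ρ i)) ∧
      (∀ i ∈ s, ρ i ∈ E i) ∧ (∀ i ∉ s, ρ i = ν i) ∧
      (Measure.pi ν).real {x | ∑ i, x i = k} ≤ (Measure.pi ρ).real {x | ∑ i, x i = k} by
    obtain ⟨ρ, _, h1, _, h2⟩ := H Finset.univ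
    exact ⟨ρ, fun i => h1 i (Finset.mem_univ i), h2⟩
  intro s
  induction s using Finset.induction_on with
  | empty => exact ⟨ν, inferInstance, by simp, fun _ _ => rfl, le_rfl⟩
  | insert i s his ih =>
    obtain ⟨ρ, hρ, hρE, hρν, hle⟩ := ih
    obtain ⟨n, rfl⟩ : ∃ n', n = n' + 1 := ⟨n - 1, by have := i.pos; omega⟩
    -- The test function is the law of the sum of the other summands, reflected about k; some of
    -- these have been replaced already.
    obtain ⟨τ, hτ, hτle⟩ := hν i
      (fun a => (Measure.pi fun j => ρ (i.succAbove j)).real {y | ∑ j, y j = k - a})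
      (fun _ => measureReal_nonneg) (fun _ => measureReal_le_one)
      (fun ε hε => finite_le_real_level _ k hε)
    have hprob : ∀ j, IsProbabilityMeasure (Function.update ρ i τ j) := by
      intro j
      by_cases hj : j = i
      · subst hj; rw [Function.update_self]; exact hE _ _ hτ
      · rw [Function.update_of_ne hj]; exact hρ j
    refine ⟨Function.update ρ i τ, hprob, fun j hj => ?_, fun j hj => ?_, hle.trans ?_⟩
    · by_cases hji : j = i
      · subst hji; rw [Function.update_self]; exact hτ
      · rw [Function.update_of_ne hji]
        exact hρE j ((Finset.mem_insert.1 hj).resolve_left hji)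
    · rw [Finset.mem_insert, not_or] at hj
      rw [Function.update_of_ne hj.1]
      exact hρν j hj.2
    · rw [pi_real_sum_eq ρ i, pi_real_sum_eq (Function.update ρ i τ) i, hρν i his]
      simpa only [Function.update_self, Function.update_of_ne (Fin.succAbove_ne i _)] using hτle

/-! ### Extremal laws and their optimality -/

/-- The number of points of the support of the extremal laws with supremum norm `1 / c`. -/
noncomputable def extremalLength (c : ℝ) : ℕ := if c ≤ 2 then 2 else ⌊c⌋₊

/-- The weights of the extremal laws: Bernoulli weights in one of the two orientations if `c ≤ 2`,
uniform weights otherwise. -/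
noncomputable def extremalWeight (c : ℝ) (b : Bool) (j : ℕ) : ℝ :=
  if c ≤ 2 then
    if j = 0 then (if b then 1 / c else 1 - 1 / c)
    else if j = 1 then (if b then 1 - 1 / c else 1 / c) else 0
  else if j < ⌊c⌋₊ then 1 / c else 0

lemma extremalWeight_of_le_two {c : ℝ} (h2 : c ≤ 2) (b : Bool) :
    extremalWeight c b 0 = (if b then 1 / c else 1 - 1 / c) ∧
    extremalWeight c b 1 = (if b then 1 - 1 / c else 1 / c) ∧
    ∀ j, 2 ≤ j → extremalWeight c b j = 0 := by
  refine ⟨by simp [extremalWeight, h2], by simp [extremalWeight, h2], fun j hj => ?_⟩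
  rw [extremalWeight, if_pos h2, if_neg (by omega), if_neg (by omega)]

lemma not_natCast_le_two {c : ℕ} (hc : 3 ≤ c) : ¬ (c : ℝ) ≤ 2 := by
  have : (3 : ℝ) ≤ c := by exact_mod_cast hc
  linarith

lemma extremalLength_natCast {c : ℕ} (hc : 3 ≤ c) : extremalLength c = c := by
  rw [extremalLength, if_neg (not_natCast_le_two hc), Nat.floor_natCast]

lemma extremalWeight_natCast {c : ℕ} (hc : 3 ≤ c) (b : Bool) (j : ℕ) :
    extremalWeight c b j = if j < c then 1 / (c : ℝ) else 0 := by
  rw [extremalWeight, if_neg (not_natCast_le_two hc), Nat.floor_natCast]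

lemma isChainWeight_of_le_two {c : ℝ} (h1 : 1 < c) (h2 : c ≤ 2) (b : Bool) :
    IsChainWeight (extremalLength c) (extremalWeight c b) := by
  obtain ⟨w0, w1, w2⟩ := extremalWeight_of_le_two h2 b
  have hlen : extremalLength c = 2 := if_pos h2
  have hp : 0 < 1 / c := by positivity
  have hq : 0 ≤ 1 - 1 / c := by
    rw [sub_nonneg, div_le_one (by linarith)]; exact h1.le
  have hnn : ∀ j, 0 ≤ extremalWeight c b j := by
    intro j
    match j with
    | 0 => rw [w0]; split_ifs <;> linarith
    | 1 => rw [w1]; split_ifs <;> linarith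
    | j + 2 => rw [w2 _ (by omega)]
  refine ⟨hnn, fun i l hil => ?_, fun j hj => w2 j (hlen ▸ hj), ?_⟩
  · rcases Nat.eq_zero_or_pos l with rfl | hl
    · obtain rfl : i = 0 := by omega
      exact (mul_comm _ _).le
    · rw [w2 (l + 1) (by omega), mul_zero]
      exact mul_nonneg (hnn _) (hnn _)
  · rw [hlen, Finset.sum_range_succ, Finset.sum_range_one, w0, w1]
    split_ifs <;> ring

lemma isChainWeight_natCast {c : ℕ} (hc : 3 ≤ c) (b : Bool) :
    IsChainWeight (extremalLength c) (extremalWeight c b) := by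
  have hw := extremalWeight_natCast hc b
  have hc0 : (0 : ℝ) < c := by exact_mod_cast (by omega : 0 < c)
  have hnn : ∀ j, 0 ≤ extremalWeight c b j := by
    intro j; rw [hw]; split_ifs <;> positivity
  refine ⟨hnn, fun i l hil => ?_, fun j hj => ?_, ?_⟩
  · by_cases h : l + 1 < c
    · rw [hw, hw, hw, hw, if_pos (by omega), if_pos h, if_pos (by omega), if_pos (by omega)]
    · rw [hw (l + 1), if_neg h, mul_zero]
      exact mul_nonneg (hnn _) (hnn _)
  · rw [extremalLength_natCast hc] at hj
    rw [hw, if_neg (by omega)]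
  · rw [extremalLength_natCast hc, Finset.sum_congr rfl fun j hj => by
      rw [hw, if_pos (Finset.mem_range.1 hj)]]
    simp [hc0.ne']

/-- The two-point laws are optimal against every test function if `c ≤ 2`. -/
lemma exists_integral_le_of_le_two {c : ℝ} (h2 : c ≤ 2) (ν : Measure ℤ)
    [IsProbabilityMeasure ν] (hν : ∀ j, ν.real {j} ≤ 1 / c) {h : ℤ → ℝ} (h0 : ∀ j, 0 ≤ h j)
    (hb : ∀ j, h j ≤ 1) (hfin : ∀ ε > 0, {j | ε ≤ h j}.Finite) :
    ∃ b : Bool, ∃ ψ : ℕ → ℤ, StrictMonoOn ψ (Set.Iio (extremalLength c)) ∧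
      ∫ j, h j ∂ν ≤ ∑ j ∈ Finset.range (extremalLength c), extremalWeight c b j * h (ψ j) := by
  obtain ⟨x, -, hx⟩ := exists_forall_notMem_le h0 hfin ∅
  obtain ⟨y, hyx, hy⟩ := exists_forall_notMem_le h0 hfin {x}
  rw [Finset.mem_singleton] at hyx
  have hlen : extremalLength c = 2 := if_pos h2
  have hint : ∫ j, h j ∂ν ≤ 1 / c * h x + (1 - 1 / c) * h y := by
    have hbt := integral_le_bathtub ν h0 hb {x} (h y) hy
    rw [Finset.sum_singleton] at hbt
    have := mul_le_mul_of_nonneg_left (hν x) (sub_nonneg.2 (hx y (Finset.notMem_empty y)))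
    linarith
  -- Mass 1 / c goes to the best point x and the rest to the runner-up y. As ψ must increase, the
  -- order of x and y dictates the orientation.
  rcases lt_or_gt_of_ne hyx with hlt | hlt
  · refine ⟨false, fun j => if j = 0 then y else x, fun i hi j hj hij => ?_, ?_⟩
    · rw [hlen, Set.mem_Iio] at hi hj
      obtain rfl : i = 0 := by omega
      obtain rfl : j = 1 := by omega
      simpa using hlt
    · obtain ⟨w0, w1, -⟩ := extremalWeight_of_le_two h2 false
      rw [hlen, Finset.sum_range_succ, Finset.sum_range_one, w0, w1]
      simp only [if_true, one_ne_zero, if_false, Bool.false_eq_true]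
      linarith
  · refine ⟨true, fun j => if j = 0 then x else y, fun i hi j hj hij => ?_, ?_⟩
    · rw [hlen, Set.mem_Iio] at hi hj
      obtain rfl : i = 0 := by omega
      obtain rfl : j = 1 := by omega
      simpa using hlt
    · obtain ⟨w0, w1, -⟩ := extremalWeight_of_le_two h2 true
      rw [hlen, Finset.sum_range_succ, Finset.sum_range_one, w0, w1]
      simp only [if_true, one_ne_zero, if_false]
      linarith

/-- The uniform laws on sets of size `c` are optimal against every test function. -/
lemma exists_integral_le_natCast {c : ℕ} (hc : 3 ≤ c) (ν : Measure ℤ)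
    [IsProbabilityMeasure ν] (hν : ∀ j, ν.real {j} ≤ 1 / c) {h : ℤ → ℝ} (h0 : ∀ j, 0 ≤ h j)
    (hb : ∀ j, h j ≤ 1) (hfin : ∀ ε > 0, {j | ε ≤ h j}.Finite) (b : Bool) :
    ∃ ψ : ℕ → ℤ, StrictMonoOn ψ (Set.Iio (extremalLength c)) ∧
      ∫ j, h j ∂ν ≤ ∑ j ∈ Finset.range (extremalLength c), extremalWeight c b j * h (ψ j) := by
  obtain ⟨A, hA, htop⟩ := exists_top_finset h0 hfin c
  have hc0 : (0 : ℝ) < c := by exact_mod_cast (by omega : 0 < c)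
  have hint : ∫ j, h j ∂ν ≤ ∑ a ∈ A, 1 / c * h a := by
    -- The threshold is the least value of h on A. As A has c points, the bound mass 1 / c on each
    -- adds up to 1 and the threshold terms cancel.
    obtain ⟨a₀, ha₀, hmin⟩ := A.exists_min_image h (Finset.card_pos.1 (by omega))
    have hbt := integral_le_bathtub ν h0 hb A (h a₀) fun d hd => htop a₀ ha₀ d hd
    have hs : ∑ a ∈ A, (h a - h a₀) * ν.real {a} ≤ ∑ a ∈ A, (h a - h a₀) * (1 / c) :=
      Finset.sum_le_sum fun a ha =>
        mul_le_mul_of_nonneg_left (hν a) (sub_nonneg.2 (hmin a ha))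
    have he : ∑ a ∈ A, (h a - h a₀) * (1 / c) = ∑ a ∈ A, 1 / c * h a - h a₀ := by
      rw [← Finset.sum_mul, Finset.sum_sub_distrib, Finset.sum_const, hA, ← Finset.mul_sum,
        nsmul_eq_mul]
      field_simp
    linarith
  set e := A.orderEmbOfFin hA with he
  refine ⟨fun j => if hj : j < c then e ⟨j, hj⟩ else 0, ?_, ?_⟩
  · rw [extremalLength_natCast hc]
    intro i hi j hj hij
    rw [Set.mem_Iio] at hi hj
    simp only [dif_pos hi, dif_pos hj]
    exact e.strictMono hij
  · rw [extremalLength_natCast hc, Finset.sum_range]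
    refine hint.trans (le_of_eq ?_)
    have himg : A = Finset.univ.map e.toEmbedding := by
      rw [he, Finset.map_orderEmbOfFin_univ]
    conv_lhs => rw [himg, Finset.sum_map]
    refine Finset.sum_congr rfl fun j _ => ?_
    rw [extremalWeight_natCast hc, if_pos j.2]
    simp only [dif_pos j.2]
    rfl

/-! ### Extreme points -/

/-- A bounded density with at most one value different from `0` and `1 / C` is extreme. -/
lemma mem_extremePoints_boundedDensities {C : ℝ} {M : Finset ℤ} {f : ℤ → ℝ}
    (hf : f ∈ boundedDensities C M) {i₀ : ℤ} (h : ∀ i ≠ i₀, f i = 0 ∨ f i = 1 / C) :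
    f ∈ Set.extremePoints ℝ (boundedDensities C M) := by
  refine ⟨hf, fun f₁ hf₁ f₂ hf₂ hseg => ?_⟩
  obtain ⟨a, b, ha, hb, hab, hcomb⟩ := hseg
  have hval : ∀ i, a * f₁ i + b * f₂ i = f i := fun i => by rw [← hcomb]; simp
  -- A value at an endpoint of [0, 1 / C] cannot be a proper average of other admissible values. The
  -- value at i₀ is then fixed by the total mass.
  have hne : ∀ i ≠ i₀, f₁ i = f i := by
    intro i hi
    by_cases hiM : i ∈ M
    · obtain ⟨p1, p2⟩ := hf₁.2.1 i hiM
      obtain ⟨q1, q2⟩ := hf₂.2.1 i hiM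
      have hv := hval i
      rcases h i hi with h0 | h1
      · rw [h0] at hv ⊢
        have := mul_nonneg ha.le p1
        have := mul_nonneg hb.le q1
        have h3 : a * f₁ i = 0 := by linarith
        exact (mul_eq_zero.1 h3).resolve_left ha.ne'
      · rw [h1] at hv ⊢
        have e1 := mul_nonneg ha.le (sub_nonneg.2 p2)
        have e2 := mul_nonneg hb.le (sub_nonneg.2 q2)
        have h3 : a * (1 / C - f₁ i) = 0 := by
          refine le_antisymm ?_ e1
          have : a * (1 / C - f₁ i) + b * (1 / C - f₂ i) = 0 := by
            linear_combination (1 / C) * hab - hv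
          linarith
        linarith [(mul_eq_zero.1 h3).resolve_left ha.ne']
    · rw [hf.1 i hiM, hf₁.1 i hiM]
  funext i
  by_cases hi : i = i₀
  · subst hi
    by_cases hiM : i ∈ M
    · have s1 := hf₁.2.2
      have s2 := hf.2.2
      rw [← Finset.add_sum_erase M _ hiM] at s1 s2
      have : ∑ x ∈ M.erase i, f₁ x = ∑ x ∈ M.erase i, f x :=
        Finset.sum_congr rfl fun x hx => hne x (Finset.ne_of_mem_erase hx)
      linarith
    · rw [hf.1 i hiM, hf₁.1 i hiM]
  · exact hne i hi

/-! ### Mass functions and min-entropy -/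

section

variable {Ω : Type*} [MeasurableSpace Ω] (P : Measure Ω) (X : Ω → ℤ)

lemma massFn_le_supNorm [IsProbabilityMeasure P] (k : ℤ) : massFn P X k ≤ supNorm (massFn P X) := by
  refine (le_abs_self _).trans (le_ciSup (f := fun k => |massFn P X k|) ⟨1, ?_⟩ k)
  rintro _ ⟨j, rfl⟩
  simp only [massFn, abs_of_nonneg measureReal_nonneg]
  exact measureReal_le_one

lemma supNorm_massFn_le {K : ℝ} (h : ∀ k, massFn P X k ≤ K) : supNorm (massFn P X) ≤ K :=
  ciSup_le fun k => by
    rw [massFn, abs_of_nonneg measureReal_nonneg]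
    exact h k

/-- Countably many null atoms cannot carry a probability. Positivity is what makes the logarithms
comparable. -/
lemma supNorm_massFn_pos [IsProbabilityMeasure P] : 0 < supNorm (massFn P X) := by
  by_contra hcon
  have hz : ∀ k, P {ω | X ω = k} = 0 := fun k => by
    have h1 := (massFn_le_supNorm P X k).trans (not_lt.1 hcon)
    exact (measureReal_eq_zero_iff).1 (le_antisymm h1 measureReal_nonneg)
  have h2 : P (⋃ k, {ω | X ω = k}) = 0 := measure_iUnion_null hz
  have h3 : (⋃ k, {ω | X ω = k}) = Set.univ := by ext ω; simp
  rw [h3, measure_univ] at h2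
  exact one_ne_zero h2

end

lemma minEntropy_le_minEntropy {Ω Ω' : Type*} [MeasurableSpace Ω] [MeasurableSpace Ω']
    (P : Measure Ω) [IsProbabilityMeasure P] (Q : Measure Ω') (X : Ω → ℤ) (Z : Ω' → ℤ)
    (h : ∀ k, massFn P X k ≤ supNorm (massFn Q Z)) : minEntropy Q Z ≤ minEntropy P X :=
  neg_le_neg (Real.log_le_log (supNorm_massFn_pos P X) (supNorm_massFn_le P X h))

/-! ### Identifying the extremal laws -/

lemma IsChainWeight.map_cast_singleton {m : ℕ} {w : ℕ → ℝ} (hw : IsChainWeight m w) (k : ℤ) :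
    (chainMeasure m w).map (fun j : ℕ => (j : ℤ)) {k} =
      ENNReal.ofReal (if 0 ≤ k then w k.toNat else 0) := by
  rw [Measure.map_apply (measurable_of_countable _) (measurableSet_singleton k)]
  split_ifs with hk
  · rw [← hw.measure_singleton]
    congr 1
    ext j
    simp only [Set.mem_preimage, Set.mem_singleton_iff]
    omega
  · rw [ENNReal.ofReal_zero]
    convert measure_empty (μ := chainMeasure m w)
    ext j
    simp only [Set.mem_preimage, Set.mem_singleton_iff, Set.mem_empty_iff_false, iff_false]
    omega

lemma map_coord {n : ℕ} {m : Fin n → ℕ} {w : Fin n → ℕ → ℝ}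
    (hw : ∀ i, IsChainWeight (m i) (w i)) (i : Fin n) :
    (Measure.pi fun i => chainMeasure (m i) (w i)).map (fun x => (x i : ℤ)) =
      (chainMeasure (m i) (w i)).map fun j : ℕ => (j : ℤ) := by
  have := fun i => (hw i).isProbabilityMeasure
  conv_rhs => rw [← (measurePreserving_eval (fun i => chainMeasure (m i) (w i)) i).map_eq,
    Measure.map_map (measurable_of_countable _) (measurable_of_countable _)]
  rfl

lemma massFn_coord {n : ℕ} {m : Fin n → ℕ} {w : Fin n → ℕ → ℝ}
    (hw : ∀ i, IsChainWeight (m i) (w i)) (i : Fin n) (k : ℤ) :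
    massFn (Measure.pi fun i => chainMeasure (m i) (w i)) (fun x => (x i : ℤ)) k =
      if 0 ≤ k then w i k.toNat else 0 := by
  have h := (hw i).map_cast_singleton k
  rw [← map_coord hw, Measure.map_apply (measurable_of_countable _) (measurableSet_singleton k)]
    at h
  rw [massFn, measureReal_def]
  refine (congrArg ENNReal.toReal h).trans (ENNReal.toReal_ofReal ?_)
  split_ifs
  · exact (hw i).nonneg _
  · exact le_rfl

lemma sum_Icc_ite_toNat (w : ℕ → ℝ) (N : ℕ) :
    ∑ k ∈ Finset.Icc (0 : ℤ) N, (if 0 ≤ k then w k.toNat else 0) =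
      ∑ j ∈ Finset.range (N + 1), w j := by
  refine (Finset.sum_bij (fun (j : ℕ) _ => (j : ℤ)) ?_ ?_ ?_ ?_).symm
  · intro j hj
    rw [Finset.mem_range] at hj
    rw [Finset.mem_Icc]; omega
  · intro i _ j _ hij; exact_mod_cast hij
  · intro k hk
    rw [Finset.mem_Icc] at hk
    exact ⟨k.toNat, by rw [Finset.mem_range]; omega, by omega⟩
  · intro j _
    rw [if_pos (Int.natCast_nonneg j), Int.toNat_natCast]

lemma IsChainWeight.mem_boundedDensities {m : ℕ} {w : ℕ → ℝ} (hw : IsChainWeight m w) {C : ℝ}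
    (hC : ∀ j, w j ≤ 1 / C) {N : ℕ} (hN : m ≤ N + 1) :
    (fun k : ℤ => if 0 ≤ k then w k.toNat else 0) ∈ boundedDensities C (Finset.Icc 0 (N : ℤ)) := by
  refine ⟨fun k hk => ?_, fun k _ => ?_, ?_⟩
  · simp only
    split_ifs with h0
    · rw [Finset.mem_Icc] at hk
      exact hw.eq_zero _ (by omega)
    · rfl
  · have h1 : 0 ≤ 1 / C := (hw.nonneg 0).trans (hC 0)
    simp only
    split_ifs
    · exact ⟨hw.nonneg _, hC _⟩
    · exact ⟨le_rfl, h1⟩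
  · rw [sum_Icc_ite_toNat, ← hw.sum_eq_one]
    refine (Finset.sum_subset (Finset.range_mono hN) fun j _ hj => ?_).symm
    exact hw.eq_zero j (by simpa using hj)

lemma extremalWeight_mem_extremePoints_of_le_two {c : ℝ} (h1 : 1 < c) (h2 : c ≤ 2) (b : Bool) :
    (fun k : ℤ => if 0 ≤ k then extremalWeight c b k.toNat else 0) ∈
      Set.extremePoints ℝ (boundedDensities c (Finset.Icc 0 ⌊c⌋)) := by
  obtain ⟨w0, w1, w2⟩ := extremalWeight_of_le_two h2 b
  have hfl : 1 ≤ ⌊c⌋ := Int.le_floor.2 (by exact_mod_cast h1.le)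
  obtain ⟨N, hN⟩ : ∃ N : ℕ, ⌊c⌋ = N := ⟨⌊c⌋.toNat, by omega⟩
  have hp : 0 < 1 / c := by positivity
  have hq : 1 - 1 / c ≤ 1 / c := by
    have : 1 / 2 ≤ 1 / c := one_div_le_one_div_of_le (by linarith) h2
    linarith
  rw [hN]
  -- The exceptional point is the one of mass 1 - 1 / c, which is at most 1 / c because c ≤ 2.
  refine mem_extremePoints_boundedDensities
    ((isChainWeight_of_le_two h1 h2 b).mem_boundedDensities ?_ ?_) (i₀ := if b then 1 else 0) ?_
  · intro j
    match j with
    | 0 => rw [w0]; split_ifs <;> linarith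
    | 1 => rw [w1]; split_ifs <;> linarith
    | j + 2 => rw [w2 _ (by omega)]; exact hp.le
  · rw [extremalLength, if_pos h2]; omega
  · intro k hk
    by_cases h0 : 0 ≤ k
    · simp only [if_pos h0]
      obtain ⟨j, rfl⟩ := Int.eq_ofNat_of_zero_le h0
      rw [Int.toNat_natCast]
      match j with
      | 0 => cases b <;> simp_all
      | 1 => cases b <;> simp_all
      | j + 2 => exact Or.inl (w2 _ (by omega))
    · exact Or.inl (if_neg h0)

lemma extremalWeight_mem_extremePoints_natCast {c : ℕ} (hc : 3 ≤ c) (b : Bool) :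
    (fun k : ℤ => if 0 ≤ k then extremalWeight c b k.toNat else 0) ∈
      Set.extremePoints ℝ (boundedDensities (c : ℝ) (Finset.Icc 0 ⌊(c : ℝ)⌋)) := by
  have hp : 0 ≤ 1 / (c : ℝ) := by positivity
  rw [Int.floor_natCast]
  refine mem_extremePoints_boundedDensities
    ((isChainWeight_natCast hc b).mem_boundedDensities ?_ ?_) (i₀ := 0) ?_
  · intro j
    rw [extremalWeight_natCast hc]
    split_ifs
    · exact le_rfl
    · exact hp
  · rw [extremalLength_natCast hc]; omega
  · intro k _
    rw [extremalWeight_natCast hc]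
    split_ifs
    · exact Or.inr rfl
    · exact Or.inl rfl
    · exact Or.inl rfl

lemma map_cast_extremal_of_le_two {c : ℝ} (h1 : 1 < c) (h2 : c ≤ 2) (b : Bool) :
    ∃ p : unitInterval, (chainMeasure (extremalLength c) (extremalWeight c b)).map
      (fun j : ℕ => (j : ℤ)) = ProbabilityTheory.bernoulliMeasure (1 : ℤ) 0 p := by
  have hw := isChainWeight_of_le_two h1 h2 b
  obtain ⟨-, -, w2⟩ := extremalWeight_of_le_two h2 b
  have hsum : extremalWeight c b 0 + extremalWeight c b 1 = 1 := by
    have := hw.sum_eq_one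
    rwa [extremalLength, if_pos h2, Finset.sum_range_succ, Finset.sum_range_one] at this
  have n0 := hw.nonneg 0
  have n1 := hw.nonneg 1
  refine ⟨⟨extremalWeight c b 1, n1, by linarith⟩, Measure.ext_of_singleton fun k => ?_⟩
  rw [hw.map_cast_singleton, ← ENNReal.ofReal_toReal (measure_ne_top _ {k})]
  congr 1
  rw [← measureReal_def, ProbabilityTheory.bernoulliMeasure_real_apply _ (measurableSet_singleton k)]
  by_cases h0 : 0 ≤ k
  · obtain ⟨j, rfl⟩ := Int.eq_ofNat_of_zero_le h0
    rw [if_pos h0, Int.toNat_natCast]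
    match j with
    | 0 => simp; linarith
    | 1 => simp
    | j + 2 =>
      have e1 : (1 : ℤ) ≠ ((j + 2 : ℕ) : ℤ) := by omega
      have e0 : (0 : ℤ) ≠ ((j + 2 : ℕ) : ℤ) := by omega
      simp only [Set.mem_singleton_iff, e1, e0, if_false]
      exact w2 _ (by omega)
  · have e1 : (1 : ℤ) ≠ k := by omega
    have e0 : (0 : ℤ) ≠ k := by omega
    simp only [if_neg h0, Set.mem_singleton_iff, e1, e0, if_false]

lemma map_cast_extremal_natCast {c : ℕ} (hc : 3 ≤ c) (b : Bool) :
    (chainMeasure (extremalLength c) (extremalWeight c b)).map (fun j : ℕ => (j : ℤ)) =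
      ProbabilityTheory.cond Measure.count (Set.Icc 0 ((c : ℤ) - 1)) := by
  refine Measure.ext_of_singleton fun k => ?_
  have hcount : Measure.count (Set.Icc 0 ((c : ℤ) - 1)) = (c : ENNReal) := by
    rw [← Finset.coe_Icc, Measure.count_apply_finset]
    simp
  rw [(isChainWeight_natCast hc b).map_cast_singleton, ProbabilityTheory.cond_apply measurableSet_Icc,
    hcount, extremalWeight_natCast hc]
  by_cases hk : k ∈ Set.Icc 0 ((c : ℤ) - 1)
  · rw [Set.inter_eq_right.2 (Set.singleton_subset_iff.2 hk), Measure.count_singleton, mul_one]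
    rw [Set.mem_Icc] at hk
    rw [if_pos hk.1, if_pos (by omega), one_div, ENNReal.ofReal_inv_of_pos, ENNReal.ofReal_natCast]
    exact_mod_cast (by omega : 0 < c)
  · rw [Set.inter_singleton_eq_empty.2 hk, measure_empty, mul_zero]
    rw [Set.mem_Icc] at hk
    split_ifs
    · omega
    · exact ENNReal.ofReal_zero
    · exact ENNReal.ofReal_zero

end MinEntropy

/-! ### Assembling the theorem -/

open MinEntropy

theorem mainTheorem7 (n : ℕ) (C : Fin n → ℝ)
    (hC : ∀ i, (1 < C i ∧ C i ≤ 2) ∨ ∃ c : ℕ, 3 ≤ c ∧ C i = (c : ℝ)) :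
    ∃ (Ω' : Type) (_ : MeasurableSpace Ω') (Q : MeasureTheory.Measure Ω')
      (_ : MeasureTheory.IsProbabilityMeasure Q) (Z : Fin n → Ω' → ℤ),
      (∀ i, Measurable (Z i)) ∧
      ProbabilityTheory.iIndepFun Z Q ∧
      (∀ i, MinEntropy.massFn Q (Z i) ∈
        Set.extremePoints ℝ (MinEntropy.boundedDensities (C i) (Finset.Icc 0 ⌊C i⌋))) ∧
      (∀ i, 1 < C i → C i ≤ 2 → ∃ p : unitInterval,
        ProbabilityTheory.HasLaw (Z i) (ProbabilityTheory.bernoulliMeasure (1 : ℤ) 0 p) Q) ∧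
      (∀ i, ∀ c : ℕ, 3 ≤ c → C i = (c : ℝ) →
        MeasureTheory.pdf.IsUniform (Z i) (Set.Icc 0 ((c : ℤ) - 1)) Q MeasureTheory.Measure.count) ∧
      ∀ {Ω : Type*} [MeasurableSpace Ω] (P : MeasureTheory.Measure Ω)
        [MeasureTheory.IsProbabilityMeasure P] (X : Fin n → Ω → ℤ),
        (∀ i, Measurable (X i)) →
        ProbabilityTheory.iIndepFun X P →
        (∀ i, MinEntropy.supNorm (MinEntropy.massFn P (X i)) ≤ 1 / C i) →
        MinEntropy.minEntropy Q (fun ω => ∑ i, Z i ω) ≤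
          MinEntropy.minEntropy P (fun ω => ∑ i, X i ω) := by
  have hw : ∀ (σ : Fin n → Bool) i,
      IsChainWeight (extremalLength (C i)) (extremalWeight (C i) (σ i)) := by
    intro σ i
    rcases hC i with ⟨h1, h2⟩ | ⟨c, hc, hCc⟩
    · exact isChainWeight_of_le_two h1 h2 _
    · rw [hCc]; exact isChainWeight_natCast hc _
  have hprob := fun σ i => (hw σ i).isProbabilityMeasure
  set law : (Fin n → Bool) → Measure (Fin n → ℕ) := fun σ =>
    Measure.pi fun i => chainMeasure (extremalLength (C i)) (extremalWeight (C i) (σ i)) with hlaw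
  have hlawprob : ∀ σ, IsProbabilityMeasure (law σ) := fun σ => by rw [hlaw]; infer_instance
  -- The orientations are chosen before any X appears, so the laws of the Z i depend on C alone.
  obtain ⟨τ, hτ⟩ := Finite.exists_max fun σ : Fin n → Bool =>
    supNorm (massFn (law σ) fun x => ∑ i, (x i : ℤ))
  refine ⟨Fin n → ℕ, inferInstance, law τ, hlawprob τ, fun i x => (x i : ℤ),
    fun i => measurable_of_countable _, ?_, ?_, ?_, ?_, ?_⟩
  · exact ProbabilityTheory.iIndepFun_pi (X := fun _ (j : ℕ) => (j : ℤ))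
      fun i => (measurable_of_countable _).aemeasurable
  · intro i
    have hmass := funext (massFn_coord (hw τ) i)
    simp only [hlaw]
    rw [hmass]
    rcases hC i with ⟨h1, h2⟩ | ⟨c, hc, hCc⟩
    · exact extremalWeight_mem_extremePoints_of_le_two h1 h2 _
    · rw [hCc]; exact extremalWeight_mem_extremePoints_natCast hc _
  · intro i h1 h2
    obtain ⟨p, hp⟩ := map_cast_extremal_of_le_two h1 h2 (τ i)
    exact ⟨p, (measurable_of_countable _).aemeasurable, (map_coord (hw τ) i).trans hp⟩
  · intro i c hc hCc
    refine (map_coord (hw τ) i).trans ?_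
    rw [hCc]
    exact map_cast_extremal_natCast hc _
  · intro Ω _ P _ X hX hind hbound
    refine minEntropy_le_minEntropy P (law τ) _ _ fun k => ?_
    have hνprob : ∀ i, IsProbabilityMeasure (P.map (X i)) := fun i =>
      Measure.isProbabilityMeasure_map (hX i).aemeasurable
    have hmass : massFn P (fun ω => ∑ i, X i ω) k =
        (Measure.pi fun i => P.map (X i)).real {x | ∑ i, x i = k} := by
      rw [← (ProbabilityTheory.iIndepFun_iff_map_fun_eq_pi_map
        fun i => (hX i).aemeasurable).1 hind,
        map_measureReal_apply (measurable_pi_lambda _ hX) (Set.to_countable _).measurableSet]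
      rfl
    have hν : ∀ i j, (P.map (X i)).real {j} ≤ 1 / C i := by
      intro i j
      rw [map_measureReal_apply (hX i) (measurableSet_singleton j)]
      exact (massFn_le_supNorm P (X i) j).trans (hbound i)
    set E : Fin n → Set (Measure ℤ) := fun i =>
      {ρ | ∃ b : Bool, ∃ ψ : ℕ → ℤ, StrictMonoOn ψ (Set.Iio (extremalLength (C i))) ∧
        ρ = (chainMeasure (extremalLength (C i)) (extremalWeight (C i) b)).map ψ} with hEdef
    have hE : ∀ i, ∀ ρ ∈ E i, IsProbabilityMeasure ρ := by
      rintro i ρ ⟨b, ψ, -, rfl⟩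
      have := hprob (fun _ => b) i
      exact Measure.isProbabilityMeasure_map (measurable_of_countable ψ).aemeasurable
    have hopt : ∀ i, ∀ h : ℤ → ℝ, (∀ j, 0 ≤ h j) → (∀ j, h j ≤ 1) →
        (∀ ε > 0, {j | ε ≤ h j}.Finite) → ∃ ρ ∈ E i, ∫ j, h j ∂P.map (X i) ≤ ∫ j, h j ∂ρ := by
      intro i h h0 hb hfin
      have key : ∃ b : Bool, ∃ ψ : ℕ → ℤ, StrictMonoOn ψ (Set.Iio (extremalLength (C i))) ∧
          ∫ j, h j ∂P.map (X i) ≤ ∑ j ∈ Finset.range (extremalLength (C i)),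
            extremalWeight (C i) b j * h (ψ j) := by
        have hνi := hν i
        rcases hC i with ⟨-, h2⟩ | ⟨c, hc, hCc⟩
        · exact exists_integral_le_of_le_two h2 _ hνi h0 hb hfin
        · rw [hCc] at hνi ⊢
          exact ⟨true, exists_integral_le_natCast hc _ hνi h0 hb hfin true⟩
      obtain ⟨b, ψ, hψ, hle⟩ := key
      refine ⟨_, ⟨b, ψ, hψ, rfl⟩, hle.trans_eq ?_⟩
      rw [integral_map (measurable_of_countable ψ).aemeasurable
        (measurable_of_countable h).aestronglyMeasurable, (hw (fun _ => b) i).integral_eq]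
    obtain ⟨ρ, hρE, hρ⟩ := exists_pi_real_sum_le (fun i => P.map (X i)) E hE hopt k
    choose σ ψ hψ hρeq using hρE
    obtain rfl : ρ = _ := funext hρeq
    rw [hmass]
    -- σ and ψ depend on X and k. The Sperner bound removes ψ, and maximality of τ removes σ.
    refine hρ.trans (pi_map_chainMeasure_le (hw σ) hψ (fun l => ?_) k)
    exact (massFn_le_supNorm (law σ) (fun x => ∑ i, (x i : ℤ)) l).trans (hτ σ)
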